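/- Let $\mathcal F$ be a weakly idempotent complete Frobenius category: an additive category with a Quillen exact structure, having enough projectives and enough injectives (relative to the exact structure), in which the projective and the injective objects coincide, and in which every split epimorphism has a kernel. Equip $\mathcal F$ with its canonical model structure: the cofibrations are the admissible monomorphisms, the fibrations are the admissible epimorphisms, and the weak equivalences are the stable equivalences, i.e. the morphisms that become invertible in the stable category $\underline{\mathcal F}$ (morphisms modulo those factoring through a projective-injective object). Let $A$ be a nonzero projective-injective object of $\mathcal F$. Give the coslice category $(A\downarrow\mathcal F)$ the induced model structure: a morphism is a cofibration, a fibration or a weak equivalence if its underlying morphism in $\mathcal F$ is one. Let $L:(A\downarrow\mathcal F)\to \mathrm{Ho}(A\downarrow\mathcal F)$ be a localization functor at the weak equivalences. Then $(A\downarrow\mathcal F)$ is not pointed (it has no zero object), but $\mathrm{Ho}(A\downarrow\mathcal F)$ is a triangulated category (including the octahedral axiom). More precisely, for $C\in\mathcal F$ put $\Phi(C)=L\bigl(A\xrightarrow{\binom{1}{0}}A\oplus C\bigr)$, and for a morphism $f$ put $\Phi(f)=L(1_A\oplus f)$. Then $\mathrm{Ho}(A\downarrow\mathcal F)$ has a triangulated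 structure with suspension $\Sigma$ together with isomorphisms $\Phi(S)\cong\Sigma\Phi(X)$, one for each conflation $X\xrightarrow{i} I\xrightarrow{p} S$ with $I$ injective and natural in morphisms of such conflations, such that the distinguished triangles are exactly those isomorphic to a triangle $$\Phi(X)\xrightarrow{\Phi(u)}\Phi(Y)\xrightarrow{\Phi(v)}\Phi(Z)\xrightarrow{\Phi(w)}\Phi(S)\cong\Sigma\Phi(X),$$ where $X\xrightarrow{i} I\xrightarrow{p} S$ is a conflation with $I$ injective, $u:X\to Y$ is any morphism, $Z$ is the pushout of $i$ along $u$ with structure morphisms $v:Y\to Z$ and $k:I\to Z$, and $w:Z\to S$ is the morphism with $wv=0$ and $wk=p$. -/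

import Mathlib

open CategoryTheory CategoryTheory.Limits

namespace FrobeniusCoslice

universe v u v' u'

section Exact

variable {C : Type u} [Category.{v} C] [Preadditive C]

/-- `f` is the first morphism of some member of the class `conf` of short complexes. -/
def IsInflationFor (conf : ObjectProperty (ShortComplex C)) {X Y : C} (f : X ⟶ Y) : Prop :=
  ∃ (Z : C) (g : Y ⟶ Z) (w : f ≫ g = 0), conf (ShortComplex.mk f g w)

/-- `g` is the second morphism of some member of the class `conf` of short complexes. -/
def IsDeflationFor (conf : ObjectProperty (ShortComplex C)) {Y Z : C} (g : Y ⟶ Z) : Prop :=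
  ∃ (X : C) (f : X ⟶ Y) (w : f ≫ g = 0), conf (ShortComplex.mk f g w)

variable (C) in
/-- A Quillen exact structure on an additive category: an isomorphism-closed class of
kernel-cokernel pairs, the conflations, such that identities are inflations and deflations,
inflations and deflations are closed under composition, pushouts of inflations along arbitrary
morphisms exist and are inflations, and pullbacks of deflations along arbitrary morphisms exist
and are deflations. -/
structure ExactStructure where
  /-- the class of conflations -/
  conflation : ObjectProperty (ShortComplex C)
  /-- the first morphism of a conflation is a kernel of the second one -/
  isKernel : ∀ S : ShortComplex C, conflation S →
    Nonempty (IsLimit (KernelFork.ofι S.f S.zero))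
  /-- the second morphism of a conflation is a cokernel of the first one -/
  isCokernel : ∀ S : ShortComplex C, conflation S →
    Nonempty (IsColimit (CokernelCofork.ofπ S.g S.zero))
  of_iso : ∀ S S' : ShortComplex C, Nonempty (S ≅ S') → conflation S → conflation S'
  id_inflation : ∀ X : C, IsInflationFor conflation (𝟙 X)
  id_deflation : ∀ X : C, IsDeflationFor conflation (𝟙 X)
  comp_inflation : ∀ {X Y Z : C} (f : X ⟶ Y) (g : Y ⟶ Z),
    IsInflationFor conflation f → IsInflationFor conflation g →
      IsInflationFor conflation (f ≫ g)
  comp_deflation : ∀ {X Y Z : C} (f : X ⟶ Y) (g : Y ⟶ Z),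
    IsDeflationFor conflation f → IsDeflationFor conflation g →
      IsDeflationFor conflation (f ≫ g)
  pushout_inflation : ∀ {X Y X' : C} (f : X ⟶ Y) (a : X ⟶ X'), IsInflationFor conflation f →
    ∃ (Y' : C) (b : Y ⟶ Y') (f' : X' ⟶ Y'),
      IsPushout f a b f' ∧ IsInflationFor conflation f'
  pullback_deflation : ∀ {Y Z Z' : C} (g : Y ⟶ Z) (c : Z' ⟶ Z), IsDeflationFor conflation g →
    ∃ (Y' : C) (b : Y' ⟶ Y) (g' : Y' ⟶ Z'),
      IsPullback b g' g c ∧ IsDeflationFor conflation g'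

variable (C) in
/-- Weak idempotent completeness: every split epimorphism has a kernel. (In an additive category
this is equivalent to: every split monomorphism has a cokernel.) -/
def IsWeaklyIdempotentComplete : Prop :=
  ∀ ⦃X Y : C⦄ (r : X ⟶ Y), IsSplitEpi r → HasKernel r

namespace ExactStructure

variable (E : ExactStructure C)

/-- Inflations, also called admissible monomorphisms. -/
def IsInflation {X Y : C} (f : X ⟶ Y) : Prop := IsInflationFor E.conflation f

/-- Deflations, also called admissible epimorphisms. -/
def IsDeflation {Y Z : C} (g : Y ⟶ Z) : Prop := IsDeflationFor E.conflation g

/-- Projective objects relative to the exact structure. -/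
def IsProjective (P : C) : Prop :=
  ∀ ⦃Y Z : C⦄ (g : Y ⟶ Z), E.IsDeflation g → ∀ h : P ⟶ Z, ∃ l : P ⟶ Y, l ≫ g = h

/-- Injective objects relative to the exact structure. -/
def IsInjective (I : C) : Prop :=
  ∀ ⦃X Y : C⦄ (f : X ⟶ Y), E.IsInflation f → ∀ h : X ⟶ I, ∃ l : Y ⟶ I, f ≫ l = h

/-- A Frobenius category: an exact category with enough projectives and enough injectives, in
which projective and injective objects coincide. -/
structure IsFrobenius : Prop where
  enough_projectives : ∀ X : C, ∃ (P : C) (p : P ⟶ X), E.IsProjective P ∧ E.IsDeflation p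
  enough_injectives : ∀ X : C, ∃ (I : C) (i : X ⟶ I), E.IsInjective I ∧ E.IsInflation i
  projective_iff_injective : ∀ X : C, E.IsProjective X ↔ E.IsInjective X

/-- Two parallel morphisms are stably equal (equal in the stable category) if their difference
factors through a projective-injective object. -/
def StablyEq {X Y : C} (f g : X ⟶ Y) : Prop :=
  ∃ (P : C) (a : X ⟶ P) (b : P ⟶ Y), E.IsProjective P ∧ E.IsInjective P ∧ a ≫ b = f - g

/-- Stable equivalences: morphisms that become invertible in the stable category. They are the
weak equivalences of the canonical model structure, whose cofibrations are the inflations and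
whose fibrations are the deflations. -/
def stableEquivalences : MorphismProperty C := fun X Y f =>
  ∃ g : Y ⟶ X, E.StablyEq (f ≫ g) (𝟙 X) ∧ E.StablyEq (g ≫ f) (𝟙 Y)

/-- The weak equivalences of the coslice category `A ↓ C`: morphisms whose underlying morphism
in `C` is a weak equivalence. -/
def coslicedWeakEquivalences (A : C) : MorphismProperty (Under A) :=
  E.stableEquivalences.under

end ExactStructure

variable [HasBinaryBiproducts C]

/-- The functor `C ⥤ (A ↓ C)` which sends `X` to the inclusion `A ⟶ A ⊞ X` and `f` to
`𝟙 A ⊞ f`. It is left adjoint to the forgetful functor. -/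
noncomputable def inclFunctor (A : C) : C ⥤ Under A where
  obj X := Under.mk (biprod.inl : A ⟶ A ⊞ X)
  map f := Under.homMk (biprod.map (𝟙 A) f) (by simp)
  map_id X := by apply Under.UnderMorphism.ext; dsimp; ext <;> simp
  map_comp f g := by apply Under.UnderMorphism.ext; dsimp; ext <;> simp

end Exact

section Triangles

variable {C : Type u} [Category.{v} C] [Preadditive C] (E : ExactStructure C)
  {H : Type u'} [Category.{v'} H] (Φ : C ⥤ H) [HasShift H ℤ]

/-- An identification of the shift functor of `H` with the suspension of the stable category along
`Φ : C ⥤ H`: for each conflation `X ⟶ I ⟶ S` with `I` injective an isomorphism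
`Φ S ≅ (Φ X)⟦1⟧`, natural with respect to morphisms of such conflations. -/
structure SuspensionIso where
  iso : ∀ S : ShortComplex C, E.conflation S → E.IsInjective S.X₂ →
    (Φ.obj S.X₃ ≅ (Φ.obj S.X₁)⟦(1 : ℤ)⟧)
  natural : ∀ (S S' : ShortComplex C) (hS : E.conflation S) (hI : E.IsInjective S.X₂)
    (hS' : E.conflation S') (hI' : E.IsInjective S'.X₂) (φ : S ⟶ S'),
    Φ.map φ.τ₃ ≫ (iso S' hS' hI').hom = (iso S hS hI).hom ≫ (Φ.map φ.τ₁)⟦(1 : ℤ)⟧'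

variable {E Φ}

/-- A triangle of `H` is standard (up to isomorphism) if it is isomorphic to the image
`Φ X ⟶ Φ Y ⟶ Φ Z ⟶ Φ S ≅ (Φ X)⟦1⟧` of a mapping cone: here `X ⟶ I ⟶ S` is a conflation with
`I` injective, `u : X ⟶ Y` is any morphism, `Z` is the pushout of `X ⟶ I` along `u`, and
`w : Z ⟶ S` vanishes on `Y` and restricts to `I ⟶ S` on `I`. -/
def SuspensionIso.IsStandardTriangle (σ : SuspensionIso E Φ) (T : Pretriangulated.Triangle H) :
    Prop :=
  ∃ (S : ShortComplex C) (hS : E.conflation S) (hI : E.IsInjective S.X₂) (Y Z : C)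
    (u : S.X₁ ⟶ Y) (v : Y ⟶ Z) (k : S.X₂ ⟶ Z) (w : Z ⟶ S.X₃),
    IsPushout S.f u k v ∧ v ≫ w = 0 ∧ k ≫ w = S.g ∧
      Nonempty (T ≅ Pretriangulated.Triangle.mk (Φ.map u) (Φ.map v)
        (Φ.map w ≫ (σ.iso S hS hI).hom))

end Triangles

end FrobeniusCoslice

/-! Adding the summand `A` is left adjoint to forgetting the structure map. As `A` is
projective-injective, the unit `X ⟶ A ⊞ X` and the counit `A ⊞ X ⟶ X` are stable equivalences, so
`Φ` is itself a localization of the Frobenius category at the stable equivalences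
(`isLocalization_inclFunctor_comp`). What remains is Happel's theorem, proved for an arbitrary such
localization `L`. The quotient by `StablyEq` is one localization, which makes every `L` full and its
target preadditive. The suspension is the cokernel of an embedding into an injective; it is an
autoequivalence because injectives are projective, and `exists_hasShift` turns it into an action of
`ℤ`. Every conflation has a connecting morphism `δ`, and the standard triangles are, up to
isomorphism, the triangles of conflations (`exists_conflation`, `isStandardTriangle_triangle`). The
axioms then concern conflations: morphisms are replaced by inflations, squares are made strictly
commutative, and the octahedron is the third isomorphism theorem `exists_noether`. -/

open scoped ZeroObject

namespace FrobeniusCoslice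

universe v u v' u'

/-! ### Exact categories: pushouts of inflations, splittings, the third isomorphism theorem. -/

section Exact

variable {C : Type u} [Category.{v} C] [Preadditive C]

namespace ExactStructure

variable {E : ExactStructure C}

section Conflation

variable {S : ShortComplex C} (hS : E.conflation S)
include hS

lemma mono_f : Mono S.f :=
  Fork.IsLimit.mono (E.isKernel S hS).some

lemma epi_g : Epi S.g :=
  Cofork.IsColimit.epi (E.isCokernel S hS).some

lemma exists_desc {T : C} (a : S.X₂ ⟶ T) (ha : S.f ≫ a = 0) : ∃ b : S.X₃ ⟶ T, S.g ≫ b = a := by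
  obtain ⟨h⟩ := E.isCokernel S hS
  exact ⟨h.desc (CokernelCofork.ofπ a ha), h.fac _ WalkingParallelPair.one⟩

lemma exists_lift {T : C} (a : T ⟶ S.X₂) (ha : a ≫ S.g = 0) : ∃ b : T ⟶ S.X₁, b ≫ S.f = a := by
  obtain ⟨h⟩ := E.isKernel S hS
  exact ⟨h.lift (KernelFork.ofι a ha), h.fac _ WalkingParallelPair.zero⟩

lemma isInflation_f : E.IsInflation S.f := ⟨_, S.g, S.zero, hS⟩

lemma isDeflation_g : E.IsDeflation S.g := ⟨_, S.f, S.zero, hS⟩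

end Conflation

/-- A short complex with an inflation as its first morphism is a conflation if its second morphism
is a cokernel. -/
lemma conflation_of_isInflation {X Y Z : C} {f : X ⟶ Y} {g : Y ⟶ Z} (hf : E.IsInflation f)
    (w : f ≫ g = 0) (h : IsColimit (CokernelCofork.ofπ g w)) :
    E.conflation (ShortComplex.mk f g w) := by
  obtain ⟨Z', g', w', h'⟩ := hf
  refine E.of_iso (ShortComplex.mk f g' w') _ ⟨ShortComplex.isoMk (Iso.refl _) (Iso.refl _)
    ((E.isCokernel _ h').some.coconePointUniqueUpToIso h) (by simp) ?_⟩ h'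
  simpa using ((E.isCokernel _ h').some.comp_coconePointUniqueUpToIso_hom h
    WalkingParallelPair.one).symm

lemma conflation_of_isDeflation {X Y Z : C} {f : X ⟶ Y} {g : Y ⟶ Z} (hg : E.IsDeflation g)
    (w : f ≫ g = 0) (h : IsLimit (KernelFork.ofι f w)) :
    E.conflation (ShortComplex.mk f g w) := by
  obtain ⟨X', f', w', h'⟩ := hg
  refine E.of_iso (ShortComplex.mk f' g w') _ ⟨ShortComplex.isoMk
    ((E.isKernel _ h').some.conePointUniqueUpToIso h) (Iso.refl _) (Iso.refl _) ?_ (by simp)⟩ h'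
  simpa using ((E.isKernel _ h').some.conePointUniqueUpToIso_hom_comp h
    WalkingParallelPair.zero)

lemma conflation_id_zero [HasZeroObject C] (X : C) :
    E.conflation (ShortComplex.mk (𝟙 X) (0 : X ⟶ 0) (by simp)) := by
  refine conflation_of_isInflation (E.id_inflation X) _ ?_
  exact CokernelCofork.IsColimit.ofπ _ _ (fun _ _ ↦ 0)
    (fun k hk ↦ by rw [← Category.id_comp k, hk, zero_comp]) (fun _ _ _ _ ↦ (isZero_zero C).eq_of_src _ _)

lemma conflation_zero_id [HasZeroObject C] (X : C) :
    E.conflation (ShortComplex.mk (0 : 0 ⟶ X) (𝟙 X) (by simp)) := by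
  refine conflation_of_isDeflation (E.id_deflation X) _ ?_
  exact KernelFork.IsLimit.ofι _ _ (fun _ _ ↦ 0)
    (fun k hk ↦ by rw [← Category.comp_id k, hk, comp_zero]) (fun _ _ _ _ ↦ (isZero_zero C).eq_of_tgt _ _)

lemma isInflation_of_isIso [HasZeroObject C] {X Y : C} (f : X ⟶ Y) [IsIso f] :
    E.IsInflation f :=
  ⟨0, 0, by simp, E.of_iso (ShortComplex.mk (𝟙 X) (0 : X ⟶ 0) (by simp)) _ ⟨ShortComplex.isoMk (Iso.refl _) (asIso f) (Iso.refl _)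
    (by simp) (by simp)⟩ (conflation_id_zero X)⟩

/-- Any pushout of an inflation is an inflation. -/
lemma isInflation_of_isPushout [HasZeroObject C] {X Y X' Y' : C} {f : X ⟶ Y} {a : X ⟶ X'}
    {b : Y ⟶ Y'} {f' : X' ⟶ Y'} (h : IsPushout f a b f') (hf : E.IsInflation f) :
    E.IsInflation f' := by
  obtain ⟨Y'', b'', f'', h', hf''⟩ := E.pushout_inflation f a hf
  have : f' = f'' ≫ (h'.isoIsPushout _ _ h).hom := by simp
  rw [this]
  exact E.comp_inflation _ _ hf'' (isInflation_of_isIso _)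

/-- The pushout of an inflation has the same cokernel. -/
lemma conflation_of_isPushout [HasZeroObject C] {S : ShortComplex C} (hS : E.conflation S)
    {X' Y' : C} {a : S.X₁ ⟶ X'} {b : S.X₂ ⟶ Y'} {f' : X' ⟶ Y'} (h : IsPushout S.f a b f')
    {g : Y' ⟶ S.X₃} (w : f' ≫ g = 0) (hg : b ≫ g = S.g) :
    E.conflation (ShortComplex.mk f' g w) := by
  refine conflation_of_isInflation (isInflation_of_isPushout h (isInflation_f hS)) _ ?_
  have := epi_g hS
  have key {T : C} (k : Y' ⟶ T) (hk : f' ≫ k = 0) : ∃ l : S.X₃ ⟶ T, g ≫ l = k := by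
    obtain ⟨l, hl⟩ := exists_desc hS (b ≫ k) (by rw [h.w_assoc, hk, comp_zero])
    exact ⟨l, h.hom_ext (by rw [reassoc_of% hg, hl]) (by rw [reassoc_of% w, zero_comp, hk])⟩
  refine CokernelCofork.IsColimit.ofπ _ _ (fun k hk ↦ (key k hk).choose)
    (fun k hk ↦ (key k hk).choose_spec) (fun k hk m hm ↦ ?_)
  rw [← cancel_epi S.g, ← hg, Category.assoc, Category.assoc, hm, (key k hk).choose_spec]

/-- If `P ⟶ Y` is a deflation, the kernel of `P ⟶ Y ⟶ Z` gives a pushout square. -/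
lemma isPushout_of_comp_deflation {S : ShortComplex C} (hS : E.conflation S)
    {T : ShortComplex C} (hT : E.conflation T) {x : T.X₁ ⟶ S.X₁} {y : T.X₂ ⟶ S.X₂}
    (hxy : T.f ≫ y = x ≫ S.f) {z : T.X₃ ⟶ S.X₃} [Mono z] (hyz : y ≫ S.g = T.g ≫ z)
    (hy : E.IsDeflation y) : IsPushout T.f x y S.f := by
  have := mono_f hS
  obtain ⟨N, n, hn, hN⟩ := hy
  -- The pullback of `y` along `S.f` is a deflation onto `S.X₁`. Its other leg is killed by `T.g`,
  -- as `z` is mono, so the deflation factors through `x`.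
  have hx : Epi x := by
    obtain ⟨Q, b, g', sq, hQ⟩ := E.pullback_deflation y S.f ⟨N, n, hn, hN⟩
    obtain ⟨_, _, _, hQ⟩ := hQ
    have := epi_g hQ
    obtain ⟨t, ht⟩ := exists_lift hT b (by
      rw [← cancel_mono z, Category.assoc, ← hyz, ← Category.assoc, sq.w]; simp)
    have : t ≫ x = g' := by
      rw [← cancel_mono S.f, Category.assoc, ← hxy, reassoc_of% ht, sq.w]
    have : Epi (t ≫ x) := by rw [this]; assumption
    exact epi_of_epi t x
  have := epi_g hN
  -- The kernel `n` of `y` factors through `T.f` by a map `m` with `m ≫ x = 0`. Hence `a` kills `n`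
  -- and descends along `y`.
  have key {W : C} (a : T.X₂ ⟶ W) (b : S.X₁ ⟶ W) (hab : T.f ≫ a = x ≫ b) :
      ∃ t : S.X₂ ⟶ W, y ≫ t = a ∧ S.f ≫ t = b := by
    obtain ⟨m, hm⟩ := exists_lift hT n (by
      rw [← cancel_mono z, Category.assoc, ← hyz, reassoc_of% hn]; simp)
    have hmx : m ≫ x = 0 := by
      rw [← cancel_mono S.f, Category.assoc, ← hxy, reassoc_of% hm, hn, zero_comp]
    obtain ⟨t, ht⟩ := exists_desc hN a (by
      have := hm =≫ a
      rw [Category.assoc, hab, reassoc_of% hmx, zero_comp] at this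
      exact this.symm)
    refine ⟨t, ht, ?_⟩
    dsimp at ht
    rw [← cancel_epi x, ← hab, ← ht, reassoc_of% hxy]
  refine ⟨⟨hxy⟩, ⟨PushoutCocone.IsColimit.mk _ (fun s ↦ (key s.inl s.inr s.condition).choose)
    (fun s ↦ (key s.inl s.inr s.condition).choose_spec.1)
    (fun s ↦ (key s.inl s.inr s.condition).choose_spec.2) (fun s m hm _ ↦ ?_)⟩⟩
  rw [← cancel_epi y]
  exact hm.trans (key s.inl s.inr s.condition).choose_spec.1.symm

section Biprod

variable [HasZeroObject C] [HasBinaryBiproducts C]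

lemma isInflation_inl (X Y : C) : E.IsInflation (biprod.inl : X ⟶ X ⊞ Y) :=
  isInflation_of_isPushout (IsPushout.of_has_biproduct X Y).flip
    (isInflation_f (conflation_zero_id Y))

/-- If `i` is an inflation, so is `(u, i)`. -/
lemma isInflation_lift {X Y I : C} (i : X ⟶ I) (hi : E.IsInflation i) (u : X ⟶ Y) :
    E.IsInflation (biprod.lift u i) := by
  -- The map `(u, i)` is the inclusion of `X`, then a shear automorphism of `X ⊞ Y`, then `i ⊞ 𝟙`,
  -- then the swap; and `i ⊞ 𝟙` is a pushout of `i`.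
  have h₁ : E.IsInflation (biprod.map i (𝟙 Y)) := by
    refine isInflation_of_isPushout (f := i) (a := biprod.inl) (b := biprod.inl)
      (IsPushout.of_left (h₁₁ := (0 : 0 ⟶ X)) (v₁₁ := (0 : 0 ⟶ Y)) (h₂₁ := biprod.inr) ?_ (by simp)
        (IsPushout.of_has_biproduct X Y)) hi
    simp [IsPushout.of_has_biproduct I Y]
  have he : IsIso (biprod.lift biprod.fst (biprod.fst ≫ u + biprod.snd) : X ⊞ Y ⟶ X ⊞ Y) :=
    ⟨biprod.lift biprod.fst (- biprod.fst ≫ u + biprod.snd), by ext <;> simp, by ext <;> simp⟩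
  have h₂ : biprod.lift u i =
      (biprod.inl ≫ biprod.lift biprod.fst (biprod.fst ≫ u + biprod.snd)) ≫
      biprod.map i (𝟙 Y) ≫ (biprod.braiding I Y).hom := by
    ext <;> simp
  rw [h₂]
  exact E.comp_inflation _ _ (E.comp_inflation _ _ (isInflation_inl X Y)
    (isInflation_of_isIso _))
    (E.comp_inflation _ _ h₁ (isInflation_of_isIso _))

/-- A pushout of an inflation `f` along `a` gives a conflation `X ⟶ X' ⊞ Y ⟶ Y'`. -/
lemma conflation_lift_of_isPushout {X Y X' Y' : C} {f : X ⟶ Y} {a : X ⟶ X'}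
    {b : Y ⟶ Y'} {f' : X' ⟶ Y'} (h : IsPushout f a b f') (hf : E.IsInflation f) :
    E.conflation (ShortComplex.mk (biprod.lift a f) (biprod.desc f' (-b)) (by simp [h.w])) := by
  refine conflation_of_isInflation (isInflation_lift f hf a) _ ?_
  refine CokernelCofork.IsColimit.ofπ _ _ (fun k hk ↦ h.desc (-(biprod.inr ≫ k)) (biprod.inl ≫ k) ?_)
    (fun k hk ↦ ?_) (fun k hk m hm ↦ ?_)
  · rw [Preadditive.comp_neg, neg_eq_iff_add_eq_zero, ← hk, biprod.lift_eq]
    simp [add_comm]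
  · ext <;> simp
  · apply h.hom_ext <;> simp [← hm]

end Biprod

/-- A conflation with injective first term splits. -/
lemma exists_splitting {S : ShortComplex C} (hS : E.conflation S) (h : E.IsInjective S.X₁) :
    ∃ (r : S.X₂ ⟶ S.X₁) (s : S.X₃ ⟶ S.X₂), s ≫ S.g = 𝟙 _ ∧ S.g ≫ s = 𝟙 _ - r ≫ S.f := by
  obtain ⟨r, hr⟩ := h S.f (isInflation_f hS) (𝟙 _)
  obtain ⟨s, hs⟩ := exists_desc hS (𝟙 _ - r ≫ S.f) (by simp [reassoc_of% hr])
  have := epi_g hS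
  exact ⟨r, s, by rw [← cancel_epi S.g, reassoc_of% hs]; simp, hs⟩

/-- The third isomorphism theorem. -/
lemma exists_noether [HasZeroObject C] {X Y Z P Q : C} {u : X ⟶ Y} {p : Y ⟶ P} {w : u ≫ p = 0}
    (h : E.conflation (ShortComplex.mk u p w)) {v : Y ⟶ Z} {q : Z ⟶ Q} {w' : v ≫ q = 0}
    (h' : E.conflation (ShortComplex.mk v q w')) :
    ∃ (R : C) (p' : Z ⟶ R) (m : P ⟶ R) (c : R ⟶ Q) (w₁ : (u ≫ v) ≫ p' = 0) (w₂ : m ≫ c = 0),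
      E.conflation (ShortComplex.mk (u ≫ v) p' w₁) ∧ E.conflation (ShortComplex.mk m c w₂) ∧
        p ≫ m = v ≫ p' ∧ p' ≫ c = q := by
  -- The pushout of `v` along `p` is a cokernel of `u ≫ v`, and its leg `m` has the same cokernel
  -- `Q` as `v`.
  obtain ⟨R, p', m, sq, -⟩ := E.pushout_inflation v p (isInflation_f h')
  have hp := epi_g h
  have hw : (u ≫ v) ≫ p' = 0 := by rw [Category.assoc, sq.w, reassoc_of% w, zero_comp]
  refine ⟨R, p', m, sq.desc q 0 (by simp [w']), hw, by simp, ?_,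
    conflation_of_isPushout h' sq _ (by simp), sq.w.symm, by simp⟩
  refine conflation_of_isInflation (E.comp_inflation _ _ (isInflation_f h) (isInflation_f h')) _ ?_
  have key {T : C} (k : Z ⟶ T) (hk : (u ≫ v) ≫ k = 0) : ∃ l : R ⟶ T, p' ≫ l = k := by
    obtain ⟨b, hb⟩ := exists_desc h (v ≫ k) (by simpa using hk)
    exact ⟨sq.desc k b hb.symm, by simp⟩
  refine CokernelCofork.IsColimit.ofπ _ _ (fun k hk ↦ (key k hk).choose)
    (fun k hk ↦ (key k hk).choose_spec) (fun k hk l hl ↦ ?_)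
  have h₁ := hl.trans (key k hk).choose_spec.symm
  refine sq.hom_ext h₁ ?_
  rw [← cancel_epi p]
  simpa [← sq.w_assoc] using v ≫= h₁

end ExactStructure

end Exact

end FrobeniusCoslice

/-- No triangle identity is needed: `η` and `ε` become invertible after localization, which makes
the two localized functors mutually inverse. -/
lemma CategoryTheory.LocalizerMorphism.isLocalizedEquivalence_of_unit_of_counit
    {C₁ C₂ : Type*} [Category* C₁] [Category* C₂]
    {W₁ : MorphismProperty C₁} {W₂ : MorphismProperty C₂}
    (Φ : LocalizerMorphism W₁ W₂) (Ψ : LocalizerMorphism W₂ W₁)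
    (η : 𝟭 C₁ ⟶ Φ.functor ⋙ Ψ.functor) (ε : Ψ.functor ⋙ Φ.functor ⟶ 𝟭 C₂)
    (hη : ∀ X₁, W₁ (η.app X₁)) (hε : ∀ X₂, W₂ (ε.app X₂)) :
    Φ.IsLocalizedEquivalence where
  isEquivalence := by
    have : IsIso (Functor.whiskerRight η W₁.Q) := by
      rw [NatTrans.isIso_iff_isIso_app]
      exact fun _ ↦ Localization.inverts W₁.Q W₁ _ (hη _)
    have : IsIso (Functor.whiskerRight ε W₂.Q) := by
      rw [NatTrans.isIso_iff_isIso_app]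
      exact fun _ ↦ Localization.inverts W₂.Q W₂ _ (hε _)
    refine (Localization.equivalence W₁.Q W₁ W₂.Q W₂ (Φ.functor ⋙ W₂.Q)
      (Φ.localizedFunctor W₁.Q W₂.Q)
      (Ψ.functor ⋙ W₁.Q) (Ψ.localizedFunctor W₂.Q W₁.Q) ?_ ?_).isEquivalence_functor
    · exact Functor.associator _ _ _ ≪≫
        Functor.isoWhiskerLeft _ (CatCommSq.iso Ψ.functor W₂.Q W₁.Q _).symm ≪≫
        (Functor.associator _ _ _).symm ≪≫
        (asIso (Functor.whiskerRight η W₁.Q)).symm ≪≫ Functor.leftUnitor _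
    · exact Functor.associator _ _ _ ≪≫
        Functor.isoWhiskerLeft _ (CatCommSq.iso Φ.functor W₁.Q W₂.Q _).symm ≪≫
        (Functor.associator _ _ _).symm ≪≫
        asIso (Functor.whiskerRight ε W₂.Q) ≪≫ Functor.leftUnitor _

namespace FrobeniusCoslice

universe v u v' u'

/-! ### The stable category as a localization, and the reduction from the coslice. -/

section Exact

variable {C : Type u} [Category.{v} C] [Preadditive C]

namespace ExactStructure

variable (E : ExactStructure C)

section Stable

variable {E}

lemma isProjective_zero [HasZeroObject C] : E.IsProjective (0 : C) :=
  fun _ _ _ _ _ ↦ ⟨0, (isZero_zero C).eq_of_src _ _⟩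

lemma isInjective_zero [HasZeroObject C] : E.IsInjective (0 : C) :=
  fun _ _ _ _ _ ↦ ⟨0, (isZero_zero C).eq_of_tgt _ _⟩

lemma IsProjective.biprod [HasBinaryBiproducts C] {P Q : C} (hP : E.IsProjective P)
    (hQ : E.IsProjective Q) : E.IsProjective (P ⊞ Q) := by
  intro Y Z g hg h
  obtain ⟨a, ha⟩ := hP g hg (biprod.inl ≫ h)
  obtain ⟨b, hb⟩ := hQ g hg (biprod.inr ≫ h)
  exact ⟨biprod.desc a b, by ext <;> simp [ha, hb]⟩

lemma IsInjective.biprod [HasBinaryBiproducts C] {I J : C} (hI : E.IsInjective I)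
    (hJ : E.IsInjective J) : E.IsInjective (I ⊞ J) := by
  intro X Y f hf h
  obtain ⟨a, ha⟩ := hI f hf (h ≫ biprod.fst)
  obtain ⟨b, hb⟩ := hJ f hf (h ≫ biprod.snd)
  exact ⟨biprod.lift a b, by ext <;> simp [ha, hb]⟩

namespace StablyEq

variable {X Y Z : C} {f g h : X ⟶ Y}

lemma refl [HasZeroObject C] (f : X ⟶ Y) : E.StablyEq f f :=
  ⟨0, 0, 0, isProjective_zero, isInjective_zero, by simp⟩

lemma symm (H : E.StablyEq f g) : E.StablyEq g f := by
  obtain ⟨P, a, b, hP, hI, hab⟩ := H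
  exact ⟨P, a, -b, hP, hI, by simp [hab]⟩

lemma add [HasBinaryBiproducts C] {f' g' : X ⟶ Y} (H : E.StablyEq f g) (H' : E.StablyEq f' g') :
    E.StablyEq (f + f') (g + g') := by
  obtain ⟨P, a, b, hP, hI, hab⟩ := H
  obtain ⟨P', a', b', hP', hI', hab'⟩ := H'
  exact ⟨P ⊞ P', biprod.lift a a', biprod.desc b b', hP.biprod hP', hI.biprod hI', by
    simp [hab, hab']; abel⟩

lemma trans [HasBinaryBiproducts C] (H : E.StablyEq f g) (H' : E.StablyEq g h) :
    E.StablyEq f h := by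
  obtain ⟨P, a, b, hP, hI, hab⟩ := H.add H'
  exact ⟨P, a, b, hP, hI, by rw [hab]; abel⟩

lemma precomp (k : Z ⟶ X) (H : E.StablyEq f g) : E.StablyEq (k ≫ f) (k ≫ g) := by
  obtain ⟨P, a, b, hP, hI, hab⟩ := H
  exact ⟨P, k ≫ a, b, hP, hI, by simp [hab]⟩

lemma postcomp (k : Y ⟶ Z) (H : E.StablyEq f g) : E.StablyEq (f ≫ k) (g ≫ k) := by
  obtain ⟨P, a, b, hP, hI, hab⟩ := H
  exact ⟨P, a, b ≫ k, hP, hI, by simp [reassoc_of% hab]⟩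

end StablyEq

end Stable

/-- The relation on morphisms whose quotient is the stable category. -/
def stableRel : HomRel C := fun _ _ f g ↦ E.StablyEq f g

variable [HasZeroObject C] [HasBinaryBiproducts C]

instance : Congruence E.stableRel where
  equivalence := ⟨StablyEq.refl, StablyEq.symm, StablyEq.trans⟩
  comp_left k _ _ H := H.precomp k
  comp_right k H := H.postcomp k

/-- The stable category is the localization of `C` at the stable equivalences. -/
instance : (Quotient.functor E.stableRel).IsLocalization E.stableEquivalences := by
  refine Quotient.isLocalization_functor _ _ ?_ ?_
  · rintro X Y f ⟨g, h₁, h₂⟩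
    exact ⟨(Quotient.functor _).map g,
      by rw [← Functor.map_comp, ← (Quotient.functor _).map_id]; exact CategoryTheory.Quotient.sound _ h₁,
      by rw [← Functor.map_comp, ← (Quotient.functor _).map_id]; exact CategoryTheory.Quotient.sound _ h₂⟩
  · rintro X Y f g ⟨P, a, b, hP, hI, hab⟩
    -- `X ⊞ P` is a cylinder on `X` with ends `(1, a)` and `(1, 0)`; the map `(g, b)` is a homotopy
    -- between `g + a ≫ b = f` and `g`.
    refine ⟨{ I := X ⊞ P, i₀ := biprod.lift (𝟙 X) a, i₁ := biprod.inl, π := biprod.fst },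
      ⟨biprod.desc g b, by simp [hab], by simp⟩, biprod.inl, ?_, ?_⟩
    · exact ⟨P, biprod.snd, -biprod.inr, hP, hI, by dsimp; ext <;> simp⟩
    · simpa using StablyEq.refl _

section Localization

variable {H : Type u'} [Category.{v'} H] (L : C ⥤ H) [L.IsLocalization E.stableEquivalences]

/-- Whether two morphisms are identified depends only on the class of weak equivalences, so it can
be tested in the quotient category. -/
lemma map_eq_iff_of_isLocalization {X Y : C} (f g : X ⟶ Y) :
    L.map f = L.map g ↔ E.StablyEq f g := by
  rw [← areEqualizedByLocalization_iff L E.stableEquivalences,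
    areEqualizedByLocalization_iff (Quotient.functor E.stableRel) E.stableEquivalences,
    Quotient.functor_map_eq_iff]
  rfl

include E in
lemma full_of_isLocalization : L.Full :=
  Functor.Full.of_iso (Localization.compUniqFunctor (Quotient.functor E.stableRel) L
    E.stableEquivalences)

/-- The localized category at the stable equivalences is preadditive. -/
@[reducible]
noncomputable def preadditiveOfIsLocalization : Preadditive H :=
  letI : Preadditive (Quotient E.stableRel) :=
    Quotient.preadditive _ (fun _ _ _ _ _ _ h h' ↦ h.add h')
  .ofFullyFaithful (Localization.uniq L (Quotient.functor E.stableRel)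
    E.stableEquivalences).fullyFaithfulFunctor

lemma additive_of_isLocalization :
    letI := E.preadditiveOfIsLocalization L
    L.Additive := by
  let : Preadditive (Quotient E.stableRel) :=
    Quotient.preadditive _ (fun _ _ _ _ _ _ h h' ↦ h.add h')
  let := E.preadditiveOfIsLocalization L
  let e := Localization.uniq L (Quotient.functor E.stableRel) E.stableEquivalences
  have h₁ : e.functor.Additive := e.fullyFaithfulFunctor.additive_ofFullyFaithful
  have h₂ : (Quotient.functor E.stableRel).Additive :=
    Quotient.functor_additive _ (fun _ _ _ _ _ _ h h' ↦ h.add h')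
  exact Functor.additive_of_iso
    (Localization.compUniqInverse L (Quotient.functor E.stableRel) E.stableEquivalences)

end Localization

section Coslice

variable {A : C}

omit [HasZeroObject C] in
lemma StablyEq.biprod_map {X Y : C} {f g : X ⟶ Y} (h : E.StablyEq f g) :
    E.StablyEq (biprod.map (𝟙 A) f) (biprod.map (𝟙 A) g) := by
  obtain ⟨P, a, b, hP, hI, hab⟩ := h
  exact ⟨P, biprod.snd ≫ a, b ≫ biprod.inr, hP, hI, by ext <;> simp [hab]⟩

omit [HasZeroObject C] in
lemma stableEquivalences_biprod_map {X Y : C} (f : X ⟶ Y) (hf : E.stableEquivalences f) :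
    E.stableEquivalences (biprod.map (𝟙 A) f) := by
  obtain ⟨g, h, h'⟩ := hf
  refine ⟨biprod.map (𝟙 A) g, ?_, ?_⟩
  · convert h.biprod_map E (A := A) using 1 <;> ext <;> simp
  · convert h'.biprod_map E (A := A) using 1 <;> ext <;> simp

/-- The unit of the adjunction; the counit is next. In both cases the error of the stable inverse
factors through `A`, which is why `A` must be projective-injective. -/
lemma stableEquivalences_inr (hP : E.IsProjective A) (hI : E.IsInjective A) (X : C) :
    E.stableEquivalences (biprod.inr : X ⟶ A ⊞ X) :=
  ⟨biprod.snd, by simpa using StablyEq.refl _, A, biprod.fst, -biprod.inl, hP, hI, by ext <;> simp⟩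

lemma stableEquivalences_desc (hP : E.IsProjective A) (hI : E.IsInjective A) {X : C} (a : A ⟶ X) :
    E.stableEquivalences (biprod.desc a (𝟙 X)) :=
  ⟨biprod.inr, ⟨A, biprod.fst, a ≫ biprod.inr - biprod.inl, hP, hI, by ext <;> simp⟩,
    by simpa using StablyEq.refl _⟩

/-- For `A` projective-injective, the functor `C ⥤ (A ↓ C)` induces an equivalence on localized
categories. -/
lemma isLocalization_inclFunctor_comp (hP : E.IsProjective A) (hI : E.IsInjective A)
    {H : Type u'} [Category.{v'} H]
    (L : Under A ⥤ H) [L.IsLocalization (E.coslicedWeakEquivalences A)] :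
    (inclFunctor A ⋙ L).IsLocalization E.stableEquivalences := by
  let Ψ : LocalizerMorphism E.stableEquivalences (E.coslicedWeakEquivalences A) :=
    { functor := inclFunctor A
      map := fun _ _ f hf ↦ E.stableEquivalences_biprod_map f hf }
  let Θ : LocalizerMorphism (E.coslicedWeakEquivalences A) E.stableEquivalences :=
    { functor := Under.forget A
      map := fun _ _ f hf ↦ hf }
  let η : 𝟭 C ⟶ Ψ.functor ⋙ Θ.functor :=
    { app X := (biprod.inr : X ⟶ A ⊞ X)
      naturality X Y f := (biprod.inr_map (𝟙 A) f).symm }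
  let ε : Θ.functor ⋙ Ψ.functor ⟶ 𝟭 (Under A) :=
    { app X := Under.homMk (biprod.desc X.hom (𝟙 X.right)) (biprod.inl_desc _ _)
      naturality X Y f := by
        have h : biprod.map (𝟙 A) f.right ≫ biprod.desc Y.hom (𝟙 Y.right) =
          biprod.desc X.hom (𝟙 X.right) ≫ f.right := by ext <;> simp
        exact Under.UnderMorphism.ext h }
  have := Ψ.isLocalizedEquivalence_of_unit_of_counit Θ η ε
    (fun X ↦ E.stableEquivalences_inr hP hI X) (fun X ↦ E.stableEquivalences_desc hP hI X.hom)
  exact LocalizerMorphism.IsLocalizedEquivalence.isLocalization Ψ L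

end Coslice

end ExactStructure

end Exact

/-! ### From an autoequivalence to an action of `ℤ`. -/

section Spectra

variable {H : Type u'} [Category.{v'} H]

/-- Sequences of objects indexed by `ℤ`, each of which is identified to the image of the previous
one by a given endofunctor. -/
structure Spectrum (G : H ⥤ H) where
  /-- the terms of the sequence -/
  X : ℤ → H
  /-- the structure isomorphisms -/
  iso (n m : ℤ) (h : n + 1 = m) : G.obj (X n) ≅ X m

namespace Spectrum

variable {G : H ⥤ H}

/-- Morphisms of spectra. -/
@[ext]
structure Hom (A B : Spectrum G) where
  /-- the components of the morphism -/
  f (n : ℤ) : A.X n ⟶ B.X n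
  comm (n m : ℤ) (h : n + 1 = m) : G.map (f n) ≫ (B.iso n m h).hom = (A.iso n m h).hom ≫ f m

instance : Category (Spectrum G) where
  Hom := Hom
  id A := { f _ := 𝟙 _, comm := by simp }
  comp φ ψ :=
    { f n := φ.f n ≫ ψ.f n
      comm n m h := by simp [ψ.comm n m h, reassoc_of% φ.comm n m h] }

@[simp]
lemma comp_f {A B D : Spectrum G} (φ : A ⟶ B) (ψ : B ⟶ D) (n : ℤ) :
    (φ ≫ ψ).f n = φ.f n ≫ ψ.f n := rfl

@[ext]
lemma hom_ext {A B : Spectrum G} {φ ψ : A ⟶ B} (h : ∀ n, φ.f n = ψ.f n) : φ = ψ :=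
  Hom.ext (funext h)

/-- The equality of two terms as an isomorphism. -/
def xIso (A : Spectrum G) (n m : ℤ) (h : n = m) : A.X n ≅ A.X m := eqToIso (by rw [h])

@[simp]
lemma xIso_hom_naturality {A B : Spectrum G} (φ : A ⟶ B) (n m : ℤ) (h : n = m) :
    (A.xIso n m h).hom ≫ φ.f m = φ.f n ≫ (B.xIso n m h).hom := by
  subst h; simp [xIso]

lemma iso_xIso (A : Spectrum G) (n m n' m' : ℤ) (h : n + 1 = m) (hn : n = n') (hm : m = m') :
    G.map (A.xIso n n' hn).hom ≫ (A.iso n' m' (by lia)).hom =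
      (A.iso n m h).hom ≫ (A.xIso m m' hm).hom := by
  subst hn hm; simp [xIso]

/-- The shift of spectra. -/
def shift (a : ℤ) : Spectrum G ⥤ Spectrum G where
  obj A :=
    { X n := A.X (n + a)
      iso n m h := A.iso _ _ (by lia) }
  map φ :=
    { f n := φ.f _
      comm _ _ _ := φ.comm _ _ _ }

@[simp]
lemma shift_map_f (a : ℤ) {A B : Spectrum G} (φ : A ⟶ B) (n : ℤ) :
    ((shift a).map φ).f n = φ.f (n + a) := rfl

/-- Constructor for isomorphisms of spectra. -/
def isoMk {A B : Spectrum G} (e : ∀ n, A.X n ≅ B.X n)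
    (h : ∀ (n m : ℤ) (h : n + 1 = m), G.map (e n).hom ≫ (B.iso n m h).hom =
      (A.iso n m h).hom ≫ (e m).hom) : A ≅ B where
  hom := { f n := (e n).hom, comm := h }
  inv :=
    { f n := (e n).inv
      comm n m hnm := by
        rw [← cancel_epi (G.map (e n).hom), ← G.map_comp_assoc, Iso.hom_inv_id, G.map_id,
          Category.id_comp, reassoc_of% h n m hnm, Iso.hom_inv_id, Category.comp_id] }

lemma eqToHom_f {A B : Spectrum G} (h : A = B) (n : ℤ) :
    Hom.f (eqToHom h) n = eqToHom (by rw [h]) := by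
  subst h; rfl

/-- The shift by zero. -/
def shiftZero : shift 0 ≅ 𝟭 (Spectrum G) :=
  NatIso.ofComponents (fun A ↦ isoMk (fun n ↦ A.xIso (n + 0) n (by simp))
    (fun _ _ _ ↦ A.iso_xIso _ _ _ _ _ _ _))
    (fun φ ↦ hom_ext (fun n ↦ (xIso_hom_naturality φ (n + 0) n (by simp)).symm))

/-- The shift by a sum. -/
def shiftAdd (a b : ℤ) : shift (a + b) ≅ shift a ⋙ shift (G := G) b :=
  NatIso.ofComponents (fun A ↦ isoMk (fun n ↦ A.xIso (n + (a + b)) (n + b + a) (by lia))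
    (fun _ _ _ ↦ A.iso_xIso _ _ _ _ _ _ _))
    (fun φ ↦ hom_ext (fun n ↦ (xIso_hom_naturality φ (n + (a + b)) (n + b + a) (by lia)).symm))

@[simp]
lemma shiftZero_inv_app_f (A : Spectrum G) (n : ℤ) :
    (shiftZero.inv.app A).f n = eqToHom (congrArg A.X (by simp)) := rfl

@[simp]
lemma shiftAdd_hom_app_f (a b : ℤ) (A : Spectrum G) (n : ℤ) :
    ((shiftAdd a b).hom.app A).f n = eqToHom (congrArg A.X (by lia)) := rfl

/-- Shifting only reindexes, so every coherence isomorphism is an `eqToHom` and the axioms reduce to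
composing these. -/
instance : HasShift (Spectrum G) ℤ :=
  hasShiftMk _ _
    { F := shift
      zero := shiftZero
      add := shiftAdd
      assoc_hom_app a b c A := by
        ext n
        simp only [comp_f, eqToHom_f, shiftAdd_hom_app_f, shift_map_f]
        erw [eqToHom_trans, eqToHom_trans, eqToHom_trans]
      zero_add_hom_app a A := by
        ext n
        simp only [comp_f, eqToHom_f, shiftAdd_hom_app_f, shift_map_f, shiftZero_inv_app_f]
        erw [eqToHom_trans]
        rfl
      add_zero_hom_app a A := by
        ext n
        simp only [comp_f, eqToHom_f, shiftAdd_hom_app_f, shiftZero_inv_app_f]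
        erw [eqToHom_trans]
        rfl }

variable (G) in
/-- The evaluation at zero. -/
@[simps]
def eval : Spectrum G ⥤ H where
  obj A := A.X 0
  map φ := φ.f 0

section

variable [G.Full] [G.Faithful]

/-- Each component determines the next through the structure isomorphisms, and the previous one
because `G` is faithful. -/
instance : (eval G).Faithful where
  map_injective {A B φ ψ} h := by
    ext n
    induction n with
    | zero => exact h
    | succ n hn =>
      rw [← cancel_epi (A.iso n _ rfl).hom, ← φ.comm, ← ψ.comm, hn]
    | pred n hn =>
      apply G.map_injective
      rw [← cancel_mono (B.iso (-n - 1) (-n) (by lia)).hom, φ.comm, ψ.comm, hn]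

/-- The nonnegative part of the extension of a morphism to a morphism of spectra. -/
def extendNat {A B : Spectrum G} (g : A.X 0 ⟶ B.X 0) : ∀ n : ℕ, A.X n ⟶ B.X n
  | 0 => g
  | n + 1 => (A.iso n _ rfl).inv ≫ G.map (extendNat g n) ≫ (B.iso n _ rfl).hom

/-- The negative part of the extension of a morphism to a morphism of spectra. -/
noncomputable def extendNeg {A B : Spectrum G} (g : A.X 0 ⟶ B.X 0) :
    ∀ n : ℕ, A.X (Int.negSucc n) ⟶ B.X (Int.negSucc n)
  | 0 => G.preimage ((A.iso _ 0 rfl).hom ≫ g ≫ (B.iso _ 0 rfl).inv)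
  | n + 1 => G.preimage ((A.iso _ (Int.negSucc n) rfl).hom ≫ extendNeg g n ≫
      (B.iso _ (Int.negSucc n) rfl).inv)

/-- The extension of a morphism to a morphism of spectra. -/
noncomputable def extend {A B : Spectrum G} (g : A.X 0 ⟶ B.X 0) : A ⟶ B where
  f
  | Int.ofNat n => extendNat g n
  | Int.negSucc n => extendNeg g n
  comm := by
    rintro n _ rfl
    obtain n | _ | n := n
    · exact (by simp [extendNat] : G.map (extendNat g n) ≫ (B.iso n _ rfl).hom =
        (A.iso n _ rfl).hom ≫ extendNat g (n + 1))
    · exact (by simp [extendNeg] : G.map (extendNeg g 0) ≫ (B.iso _ 0 rfl).hom =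
        (A.iso _ 0 rfl).hom ≫ g)
    · exact (by simp [extendNeg] : G.map (extendNeg g (n + 1)) ≫ (B.iso _ (Int.negSucc n) rfl).hom =
        (A.iso _ (Int.negSucc n) rfl).hom ≫ extendNeg g n)

instance : (eval G).Full where
  map_surjective g := ⟨extend g, rfl⟩

end

variable [G.IsEquivalence]

variable (G) in
/-- The terms of the spectrum attached to an object. -/
noncomputable def freeX (Y : H) : ℤ → H
  | Int.ofNat n => Nat.rec Y (fun _ ↦ G.obj) n
  | Int.negSucc n => Nat.rec (G.inv.obj Y) (fun _ ↦ G.inv.obj) n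

variable (G) in
/-- The structure isomorphisms of the spectrum attached to an object. -/
noncomputable def freeIso (Y : H) : ∀ n : ℤ, G.obj (freeX G Y n) ≅ freeX G Y (n + 1)
  | Int.ofNat _ => Iso.refl _
  | Int.negSucc 0 => G.asEquivalence.counitIso.app Y
  | Int.negSucc (n + 1) => G.asEquivalence.counitIso.app (freeX G Y (Int.negSucc n))

instance : (eval G).EssSurj where
  mem_essImage Y :=
    ⟨{ X := freeX G Y, iso n m h := freeIso G Y n ≪≫ eqToIso (by rw [h]) }, ⟨Iso.refl _⟩⟩

instance : (eval G).IsEquivalence where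

end Spectrum

/-- An autoequivalence is the shift by one of an action of `ℤ`. -/
lemma exists_hasShift (G : H ⥤ H) [G.IsEquivalence] :
    ∃ (_ : HasShift H ℤ), Nonempty (shiftFunctor H (1 : ℤ) ≅ G) := by
  -- The shift of spectra is transported along evaluation at zero. After shifting by one, the term
  -- at zero is `X 1 ≅ G (X 0)`, so the shift by one becomes `G`.
  let e := (Spectrum.eval G).asEquivalence
  let s (a : ℤ) : H ⥤ H := e.inverse ⋙ shiftFunctor (Spectrum G) a ⋙ e.functor
  let i (a : ℤ) : Spectrum.eval G ⋙ s a ≅ shiftFunctor (Spectrum G) a ⋙ Spectrum.eval G :=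
    (Functor.associator _ _ _).symm ≪≫ Functor.isoWhiskerRight e.unitIso.symm _ ≪≫
      Functor.leftUnitor _
  refine ⟨HasShift.induced (Spectrum.eval G) ℤ s i, ⟨?_⟩⟩
  let j : shiftFunctor (Spectrum G) (1 : ℤ) ⋙ Spectrum.eval G ≅ Spectrum.eval G ⋙ G :=
    NatIso.ofComponents (fun A ↦ (A.iso 0 (0 + 1) rfl).symm) (fun {A B} φ ↦ by
      have h : φ.f (0 + 1) ≫ (B.iso 0 (0 + 1) rfl).inv =
          (A.iso 0 (0 + 1) rfl).inv ≫ G.map (φ.f 0) := by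
        rw [Iso.eq_inv_comp, ← Category.assoc, Iso.comp_inv_eq]
        exact (φ.comm 0 (0 + 1) rfl).symm
      exact h)
  exact Functor.isoWhiskerLeft e.inverse j ≪≫ (Functor.associator _ _ _).symm ≪≫
    Functor.isoWhiskerRight e.counitIso _ ≪≫ Functor.leftUnitor _

end Spectra

/-! ### The suspension on the stable category. -/

section Exact

variable {C : Type u} [Category.{v} C] [Preadditive C]

namespace ExactStructure

variable {E : ExactStructure C}

lemma exists_hom_of_isInjective {S S' : ShortComplex C} (hS : E.conflation S)
    (hI : E.IsInjective S'.X₂) (a : S.X₁ ⟶ S'.X₁) : ∃ φ : S ⟶ S', φ.τ₁ = a := by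
  obtain ⟨b, hb⟩ := hI S.f (isInflation_f hS) (a ≫ S'.f)
  obtain ⟨c, hc⟩ := exists_desc hS (b ≫ S'.g) (by simp [reassoc_of% hb])
  exact ⟨ShortComplex.homMk a b c hb.symm hc.symm, rfl⟩

lemma exists_hom_of_isProjective {S S' : ShortComplex C} (hS' : E.conflation S')
    (hP : E.IsProjective S.X₂) (c : S.X₃ ⟶ S'.X₃) : ∃ φ : S ⟶ S', φ.τ₃ = c := by
  obtain ⟨b, hb⟩ := hP S'.g (isDeflation_g hS') (S.g ≫ c)
  obtain ⟨a, ha⟩ := exists_lift hS' (S.f ≫ b) (by simp [hb])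
  exact ⟨ShortComplex.homMk a b c ha hb, rfl⟩

/-- This makes the suspension well defined. The factorization on first terms extends along `S.f`;
once its contribution is subtracted, the difference of the middle components descends to `S.X₃ ⟶
S'.X₂`, through which `φ.τ₃ - ψ.τ₃` factors. -/
lemma StablyEq.τ₃ {S S' : ShortComplex C} (hS : E.conflation S)
    (hP : E.IsProjective S'.X₂) (hI : E.IsInjective S'.X₂) {φ ψ : S ⟶ S'}
    (h : E.StablyEq φ.τ₁ ψ.τ₁) : E.StablyEq φ.τ₃ ψ.τ₃ := by
  obtain ⟨Q, a, b, hQ, hJ, hab⟩ := h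
  obtain ⟨a', ha'⟩ := hJ S.f (isInflation_f hS) a
  obtain ⟨t, ht⟩ := exists_desc hS (φ.τ₂ - ψ.τ₂ - a' ≫ b ≫ S'.f) (by
    simp [reassoc_of% ha', reassoc_of% hab, ← φ.comm₁₂, ← ψ.comm₁₂])
  have := epi_g hS
  refine ⟨_, t, S'.g, hP, hI, ?_⟩
  rw [← cancel_epi S.g, reassoc_of% ht]
  simp [φ.comm₂₃, ψ.comm₂₃]

/-- The dual argument, which gives faithfulness of the suspension. -/
lemma StablyEq.τ₁ {S S' : ShortComplex C} (hS' : E.conflation S')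
    (hP : E.IsProjective S.X₂) (hI : E.IsInjective S.X₂) {φ ψ : S ⟶ S'}
    (h : E.StablyEq φ.τ₃ ψ.τ₃) : E.StablyEq φ.τ₁ ψ.τ₁ := by
  obtain ⟨Q, a, b, hQ, hJ, hab⟩ := h
  obtain ⟨b', hb'⟩ := hQ S'.g (isDeflation_g hS') b
  obtain ⟨t, ht⟩ := exists_lift hS' (φ.τ₂ - ψ.τ₂ - S.g ≫ a ≫ b') (by
    simp [hb', hab, φ.comm₂₃, ψ.comm₂₃])
  have := mono_f hS'
  refine ⟨_, S.f, t, hP, hI, ?_⟩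
  rw [← cancel_mono S'.f, Category.assoc, ht]
  simp [φ.comm₁₂, ψ.comm₁₂]

namespace IsFrobenius

variable (hF : E.IsFrobenius)
include hF

lemma isProjective {I : C} (hI : E.IsInjective I) : E.IsProjective I :=
  (hF.projective_iff_injective I).2 hI

lemma isInjective {P : C} (hP : E.IsProjective P) : E.IsInjective P :=
  (hF.projective_iff_injective P).1 hP

lemma exists_conflation_of_source (X : C) : ∃ (I S : C) (i : X ⟶ I) (p : I ⟶ S) (w : i ≫ p = 0),
    E.conflation (ShortComplex.mk i p w) ∧ E.IsInjective I := by
  obtain ⟨I, i, hI, S, p, w, h⟩ := hF.enough_injectives X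
  exact ⟨I, S, i, p, w, h, hI⟩

lemma exists_conflation_of_target (X : C) : ∃ (K P : C) (i : K ⟶ P) (p : P ⟶ X) (w : i ≫ p = 0),
    E.conflation (ShortComplex.mk i p w) ∧ E.IsInjective P := by
  obtain ⟨P, p, hP, K, i, w, h⟩ := hF.enough_projectives X
  exact ⟨K, P, i, p, w, h, hF.isInjective hP⟩

/-- A chosen conflation starting from a given object, with an injective middle term. -/
noncomputable abbrev hull (X : C) : ShortComplex C :=
  ShortComplex.mk (X₁ := X) _ _
    (hF.exists_conflation_of_source X).choose_spec.choose_spec.choose_spec.choose_spec.choose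

lemma conflation_hull (X : C) : E.conflation (hF.hull X) :=
  (hF.exists_conflation_of_source X).choose_spec.choose_spec.choose_spec.choose_spec.choose_spec.1

lemma isInjective_hull (X : C) : E.IsInjective (hF.hull X).X₂ :=
  (hF.exists_conflation_of_source X).choose_spec.choose_spec.choose_spec.choose_spec.choose_spec.2

/-- The morphism of short complexes to the chosen conflation. -/
noncomputable def homHull {S : ShortComplex C} (hS : E.conflation S) {Y : C} (f : S.X₁ ⟶ Y) :
    S ⟶ hF.hull Y :=
  (exists_hom_of_isInjective (S' := hF.hull Y) hS (hF.isInjective_hull Y) f).choose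

@[simp]
lemma homHull_τ₁ {S : ShortComplex C} (hS : E.conflation S) {Y : C} (f : S.X₁ ⟶ Y) :
    (hF.homHull hS f).τ₁ = f :=
  (exists_hom_of_isInjective (S' := hF.hull Y) hS (hF.isInjective_hull Y) f).choose_spec

variable [HasZeroObject C] [HasBinaryBiproducts C]
  {H : Type u'} [Category.{v'} H] (L : C ⥤ H) [L.IsLocalization E.stableEquivalences]

lemma map_τ₃_eq {S S' : ShortComplex C} (hS : E.conflation S) (hI : E.IsInjective S'.X₂)
    {φ ψ : S ⟶ S'} (h : L.map φ.τ₁ = L.map ψ.τ₁) : L.map φ.τ₃ = L.map ψ.τ₃ := by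
  rw [E.map_eq_iff_of_isLocalization] at h ⊢
  exact h.τ₃ hS (hF.isProjective hI) hI

lemma map_τ₁_eq {S S' : ShortComplex C} (hS' : E.conflation S') (hI : E.IsInjective S.X₂)
    {φ ψ : S ⟶ S'} (h : L.map φ.τ₃ = L.map ψ.τ₃) : L.map φ.τ₁ = L.map ψ.τ₁ := by
  rw [E.map_eq_iff_of_isLocalization] at h ⊢
  exact h.τ₁ hS' (hF.isProjective hI) hI

lemma map_τ₃_comp {S S' S'' : ShortComplex C} (hS : E.conflation S) (hI : E.IsInjective S''.X₂)
    {φ : S ⟶ S'} {ψ : S' ⟶ S''} {χ : S ⟶ S''} (h : φ.τ₁ ≫ ψ.τ₁ = χ.τ₁) :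
    L.map φ.τ₃ ≫ L.map ψ.τ₃ = L.map χ.τ₃ := by
  rw [← L.map_comp, ← ShortComplex.comp_τ₃]
  exact hF.map_τ₃_eq L hS hI (by rw [← h, ShortComplex.comp_τ₁])

lemma map_τ₃_id {S : ShortComplex C} (hS : E.conflation S) (hI : E.IsInjective S.X₂)
    {φ : S ⟶ S} (h : φ.τ₁ = 𝟙 _) : L.map φ.τ₃ = 𝟙 _ := by
  rw [← L.map_id, ← ShortComplex.id_τ₃]
  exact hF.map_τ₃_eq L hS hI (by rw [h, ShortComplex.id_τ₁])

/-- The suspension, as a functor from the Frobenius category. -/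
noncomputable def suspFunctor : C ⥤ H where
  obj X := L.obj (hF.hull X).X₃
  map f := L.map (hF.homHull (hF.conflation_hull _) f).τ₃
  map_id X := hF.map_τ₃_id L (hF.conflation_hull _) (hF.isInjective_hull _) (homHull_τ₁ ..)
  map_comp f g := (hF.map_τ₃_comp L (hF.conflation_hull _) (hF.isInjective_hull _) (by
    rw [homHull_τ₁, homHull_τ₁, homHull_τ₁])).symm

lemma suspFunctor_map_congr {X Y : C} {f g : X ⟶ Y} (h : L.map f = L.map g) :
    (hF.suspFunctor L).map f = (hF.suspFunctor L).map g :=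
  hF.map_τ₃_eq L (hF.conflation_hull _) (hF.isInjective_hull _) (by rwa [homHull_τ₁, homHull_τ₁])

lemma isInvertedBy_suspFunctor : E.stableEquivalences.IsInvertedBy (hF.suspFunctor L) := by
  rintro X Y f ⟨g, h, h'⟩
  rw [← E.map_eq_iff_of_isLocalization L] at h h'
  refine ⟨(hF.suspFunctor L).map g, ?_, ?_⟩
  · rw [← Functor.map_comp, ← (hF.suspFunctor L).map_id]
    exact hF.suspFunctor_map_congr L h
  · rw [← Functor.map_comp, ← (hF.suspFunctor L).map_id]
    exact hF.suspFunctor_map_congr L h'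

/-- The suspension on the localized category. -/
noncomputable def suspension : H ⥤ H :=
  Localization.lift (hF.suspFunctor L) (hF.isInvertedBy_suspFunctor L) L

/-- The suspension on the localized category lifts `suspFunctor`. -/
noncomputable def suspensionFac : L ⋙ hF.suspension L ≅ hF.suspFunctor L :=
  Localization.fac _ _ _

/-- The last term of any conflation with injective middle term is isomorphic to the suspension
of the first one. -/
noncomputable def suspComparison {S : ShortComplex C} (hS : E.conflation S)
    (hI : E.IsInjective S.X₂) : L.obj S.X₃ ≅ (hF.suspFunctor L).obj S.X₁ where
  hom := L.map (hF.homHull hS (𝟙 S.X₁)).τ₃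
  inv := L.map (exists_hom_of_isInjective (hF.conflation_hull S.X₁) hI (𝟙 S.X₁)).choose.τ₃
  hom_inv_id := by
    refine (hF.map_τ₃_comp L (χ := 𝟙 S) hS hI ?_).trans (L.map_id _)
    rw [homHull_τ₁, (exists_hom_of_isInjective (hF.conflation_hull S.X₁) hI (𝟙 S.X₁)).choose_spec]
    exact Category.comp_id _
  inv_hom_id := by
    refine (hF.map_τ₃_comp L (χ := 𝟙 (hF.hull S.X₁)) (hF.conflation_hull _)
      (hF.isInjective_hull _) ?_).trans (L.map_id _)
    rw [homHull_τ₁, (exists_hom_of_isInjective (hF.conflation_hull S.X₁) hI (𝟙 S.X₁)).choose_spec]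
    exact Category.comp_id _

lemma suspComparison_naturality {S S' : ShortComplex C} (hS : E.conflation S)
    (hI : E.IsInjective S.X₂) (hS' : E.conflation S') (hI' : E.IsInjective S'.X₂) (φ : S ⟶ S') :
    L.map φ.τ₃ ≫ (hF.suspComparison L hS' hI').hom =
      (hF.suspComparison L hS hI).hom ≫ (hF.suspFunctor L).map φ.τ₁ :=
  (hF.map_τ₃_comp L (χ := hF.homHull hS φ.τ₁) hS (hF.isInjective_hull _) (by simp)).trans
    (hF.map_τ₃_comp L (χ := hF.homHull hS φ.τ₁) hS (hF.isInjective_hull _) (by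
      rw [homHull_τ₁, homHull_τ₁, homHull_τ₁]; exact Category.id_comp _)).symm

/-- The Frobenius condition lets conflations be read from right to left: an object is the suspension
of the kernel of a projective cover map, and morphisms of third terms lift to first terms. -/
instance : (hF.suspFunctor L).EssSurj := by
  have := Localization.essSurj L E.stableEquivalences
  refine ⟨fun Z ↦ ?_⟩
  obtain ⟨K, P, i, p, w, h, hP⟩ := hF.exists_conflation_of_target (L.objPreimage Z)
  exact ⟨K, ⟨(hF.suspComparison L h hP).symm ≪≫ L.objObjPreimageIso Z⟩⟩

instance : (hF.suspFunctor L).Full := by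
  have := E.full_of_isLocalization L
  refine ⟨fun {X Y} g ↦ ?_⟩
  obtain ⟨g, rfl⟩ := L.map_surjective g
  obtain ⟨φ, rfl⟩ := exists_hom_of_isProjective (S := hF.hull X) (hF.conflation_hull Y)
    (hF.isProjective (hF.isInjective_hull X)) g
  exact ⟨φ.τ₁, hF.map_τ₃_eq L (hF.conflation_hull _) (hF.isInjective_hull _) (by simp)⟩

instance : (hF.suspension L).EssSurj := by
  have : (L ⋙ hF.suspension L).EssSurj := Functor.essSurj_of_iso (hF.suspensionFac L).symm
  exact ⟨fun Z ↦ ⟨L.obj ((L ⋙ hF.suspension L).objPreimage Z),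
    ⟨(L ⋙ hF.suspension L).objObjPreimageIso Z⟩⟩⟩

instance : (hF.suspension L).Full := by
  have := Localization.essSurj L E.stableEquivalences
  have : (L ⋙ hF.suspension L).Full := Functor.Full.of_iso (hF.suspensionFac L).symm
  exact Functor.full_of_comp_essSurj _ L (fun X Y g ↦ ⟨_, (L ⋙ hF.suspension L).map_preimage g⟩)

instance : (hF.suspension L).Faithful := by
  have := Localization.essSurj L E.stableEquivalences
  have := E.full_of_isLocalization L
  refine Functor.faithful_of_comp_essSurj _ L (fun X Y f g h ↦ ?_)
  obtain ⟨f, rfl⟩ := L.map_surjective f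
  obtain ⟨g, rfl⟩ := L.map_surjective g
  have h' : (hF.suspFunctor L).map f = (hF.suspFunctor L).map g := by
    rw [← cancel_epi ((hF.suspensionFac L).hom.app X), ← NatTrans.naturality,
      ← NatTrans.naturality, Functor.comp_map, h, Functor.comp_map]
  simpa using hF.map_τ₁_eq L (hF.conflation_hull _) (hF.isInjective_hull _) h'

instance : (hF.suspension L).IsEquivalence where

lemma exists_suspensionIso :
    ∃ (_ : HasShift H ℤ), Nonempty (SuspensionIso E L) := by
  obtain ⟨h, ⟨e⟩⟩ := exists_hasShift (hF.suspension L)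
  let e' : hF.suspFunctor L ≅ L ⋙ shiftFunctor H (1 : ℤ) :=
    (hF.suspensionFac L).symm ≪≫ Functor.isoWhiskerLeft L e.symm
  refine ⟨h, ⟨{ iso := fun S hS hI ↦ hF.suspComparison L hS hI ≪≫ e'.app S.X₁, natural := ?_ }⟩⟩
  intro S S' hS hI hS' hI' φ
  have := e'.hom.naturality φ.τ₁
  dsimp at this ⊢
  rw [← Category.assoc, suspComparison_naturality hF L hS hI hS' hI', Category.assoc, this,
    Category.assoc]

end IsFrobenius

end ExactStructure

end Exact

/-! ### Triangles of conflations and the axioms of triangulated categories. -/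

section Triangulation

open Pretriangulated ExactStructure ExactStructure.IsFrobenius

variable {C : Type u} [Category.{v} C] [Preadditive C] [HasZeroObject C] [HasBinaryBiproducts C]
  {E : ExactStructure C} (hF : E.IsFrobenius)
  {H : Type u'} [Category.{v'} H] {L : C ⥤ H} [L.IsLocalization E.stableEquivalences]

omit [HasZeroObject C] [HasBinaryBiproducts C] in
include hF in
lemma ExactStructure.IsFrobenius.stablyEq_of_fac {X I Y : C} {f g : X ⟶ Y} (hI : E.IsInjective I)
    (a : X ⟶ I) (b : I ⟶ Y) (h : a ≫ b = f - g) : E.StablyEq f g :=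
  ⟨I, a, b, hF.isProjective hI, hI, h⟩

variable (L) in
include hF in
lemma ExactStructure.IsFrobenius.map_eq_of_fac {X I Y : C} {f g : X ⟶ Y} (hI : E.IsInjective I)
    (a : X ⟶ I) (b : I ⟶ Y) (h : a ≫ b = f - g) : L.map f = L.map g :=
  (E.map_eq_iff_of_isLocalization L _ _).2 (hF.stablyEq_of_fac hI a b h)

variable (L) in
include hF in
lemma ExactStructure.IsFrobenius.isIso_map_inl {X I : C} (hI : E.IsInjective I) :
    IsIso (L.map (biprod.inl : X ⟶ X ⊞ I)) :=
  ⟨L.map biprod.fst, by simp [← L.map_comp], by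
    rw [← L.map_comp, ← L.map_id]
    exact hF.map_eq_of_fac L hI biprod.snd (-biprod.inr) (by ext <;> simp)⟩

variable (L) in
include hF in
/-- A deflation with injective kernel is a stable equivalence. -/
lemma ExactStructure.IsFrobenius.isIso_map_g {S : ShortComplex C} (hS : E.conflation S)
    (hI : E.IsInjective S.X₁) : IsIso (L.map S.g) := by
  obtain ⟨r, s, h, h'⟩ := exists_splitting hS hI
  refine ⟨L.map s, ?_, by rw [← L.map_comp, h, L.map_id]⟩
  rw [← L.map_comp, ← L.map_id]
  exact hF.map_eq_of_fac L hI (-r) S.f (by simp [h'])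

variable (L) in
include hF in
/-- Up to isomorphism, any morphism in the localized category is the image of an inflation. -/
lemma ExactStructure.IsFrobenius.exists_inflation {y z : H} (h : y ⟶ z) {Y : C} (e : y ≅ L.obj Y) :
    ∃ (Z W : C) (f : Y ⟶ Z) (g : Z ⟶ W) (w : f ≫ g = 0) (e' : z ≅ L.obj Z),
      E.conflation (ShortComplex.mk f g w) ∧ h ≫ e'.hom = e.hom ≫ L.map f := by
  have := Localization.essSurj L E.stableEquivalences
  have := E.full_of_isLocalization L
  obtain ⟨Z, ⟨e'⟩⟩ : ∃ Z, Nonempty (z ≅ L.obj Z) := ⟨_, ⟨(L.objObjPreimageIso z).symm⟩⟩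
  obtain ⟨f, hf⟩ := L.map_surjective (e.inv ≫ h ≫ e'.hom)
  -- Adding an injective hull of `Y` to the target does not change it stably, and turns `f` into the
  -- inflation `(f, i)`.
  obtain ⟨I, i, hI, hi⟩ := hF.enough_injectives Y
  obtain ⟨W, g, w, hg⟩ := isInflation_lift i hi f
  have := hF.isIso_map_inl L (X := Z) hI
  refine ⟨Z ⊞ I, W, biprod.lift f i, g, w, e' ≪≫ asIso (L.map biprod.inl), hg, ?_⟩
  have h₁ : L.map (biprod.lift f i) = L.map (f ≫ biprod.inl) :=
    hF.map_eq_of_fac L hI i biprod.inr (by ext <;> simp)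
  rw [h₁, L.map_comp, hf]
  simp

include hF in
-- The failure of the lifted square to commute factors through an injective, hence extends along the
-- inflation `S.f`. Subtracting the extension from `b` corrects the square without changing the
-- stable class.
lemma ExactStructure.IsFrobenius.exists_hom_of_comm {S S' : ShortComplex C} (hS : E.conflation S)
    (a : L.obj S.X₁ ⟶ L.obj S'.X₁) (b : L.obj S.X₂ ⟶ L.obj S'.X₂)
    (hab : L.map S.f ≫ b = a ≫ L.map S'.f) : ∃ φ : S ⟶ S', L.map φ.τ₁ = a ∧ L.map φ.τ₂ = b := by
  have := E.full_of_isLocalization L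
  obtain ⟨a, rfl⟩ := L.map_surjective a
  obtain ⟨b, rfl⟩ := L.map_surjective b
  rw [← L.map_comp, ← L.map_comp, E.map_eq_iff_of_isLocalization] at hab
  obtain ⟨P, c, d, hP, hI, hcd⟩ := hab
  obtain ⟨c', hc'⟩ := hI S.f (isInflation_f hS) c
  have comm : S.f ≫ (b - c' ≫ d) = a ≫ S'.f := by simp [reassoc_of% hc', hcd]
  obtain ⟨t, ht⟩ := exists_desc hS ((b - c' ≫ d) ≫ S'.g) (by
    rw [reassoc_of% comm, S'.zero, comp_zero])
  refine ⟨ShortComplex.homMk a (b - c' ≫ d) t comm.symm ht.symm, rfl, ?_⟩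
  exact hF.map_eq_of_fac L hI (-c') d (by simp)

variable [HasShift H ℤ]

lemma exists_hom₃_of_iso {T T' D D' : Triangle H} (e : T ≅ D) (e' : T' ≅ D')
    (h : ∀ (a : D.obj₁ ⟶ D'.obj₁) (b : D.obj₂ ⟶ D'.obj₂), D.mor₁ ≫ b = a ≫ D'.mor₁ →
      ∃ c : D.obj₃ ⟶ D'.obj₃, D.mor₂ ≫ c = b ≫ D'.mor₂ ∧ D.mor₃ ≫ a⟦1⟧' = c ≫ D'.mor₃)
    (a : T.obj₁ ⟶ T'.obj₁) (b : T.obj₂ ⟶ T'.obj₂) (hab : T.mor₁ ≫ b = a ≫ T'.mor₁) :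
    ∃ c : T.obj₃ ⟶ T'.obj₃, T.mor₂ ≫ c = b ≫ T'.mor₂ ∧ T.mor₃ ≫ a⟦1⟧' = c ≫ T'.mor₃ := by
  have comm : D.mor₁ ≫ e.inv.hom₂ ≫ b ≫ e'.hom.hom₂ =
      (e.inv.hom₁ ≫ a ≫ e'.hom.hom₁) ≫ D'.mor₁ := by
    simp [reassoc_of% e.inv.comm₁, reassoc_of% hab, e'.hom.comm₁]
  obtain ⟨c, h₁, h₂⟩ := h _ _ comm
  let ψ : D ⟶ D' := { hom₁ := _, hom₂ := _, hom₃ := c, comm₁ := comm, comm₂ := h₁, comm₃ := h₂ }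
  let χ := e.hom ≫ ψ ≫ e'.inv
  have ha : χ.hom₁ = a := by simp [χ, ψ]
  have hb : χ.hom₂ = b := by simp [χ, ψ]
  exact ⟨χ.hom₃, by rw [χ.comm₂, hb], by rw [← χ.comm₃, ha]⟩

/-- Constructor for isomorphisms between triangles given by their morphisms. -/
def triangleMkIso {X Y Z X' Y' Z' : H} {f : X ⟶ Y} {g : Y ⟶ Z} {h : Z ⟶ X⟦(1 : ℤ)⟧}
    {f' : X' ⟶ Y'} {g' : Y' ⟶ Z'} {h' : Z' ⟶ X'⟦(1 : ℤ)⟧} (e₁ : X ≅ X') (e₂ : Y ≅ Y')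
    (e₃ : Z ≅ Z') (hf : f ≫ e₂.hom = e₁.hom ≫ f') (hg : g ≫ e₃.hom = e₂.hom ≫ g')
    (hh : h ≫ e₁.hom⟦(1 : ℤ)⟧' = e₃.hom ≫ h') : Triangle.mk f g h ≅ Triangle.mk f' g' h' :=
  Triangle.isoMk _ _ e₁ e₂ e₃ hf hg hh

variable [Preadditive H]

namespace SuspensionIso

section

variable (σ : SuspensionIso E L)

/-- The connecting morphism of a conflation. -/
noncomputable def δ {S : ShortComplex C} (hS : E.conflation S) :
    L.obj S.X₃ ⟶ (L.obj S.X₁)⟦(1 : ℤ)⟧ :=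
  -- The sign matches the conflation `X ⟶ Y ⊞ I ⟶ Z` with second map `(v, -k)`, which maps to `X ⟶ I
  -- ⟶ S` by `-w` on third terms.
  -(L.map (hF.homHull hS (𝟙 S.X₁)).τ₃ ≫
    (σ.iso (hF.hull S.X₁) (hF.conflation_hull _) (hF.isInjective_hull _)).hom)

/-- Naturality of `σ` along a map from the chosen hull to `S'` shows that `δ` may be computed with
any conflation whose middle term is injective. -/
lemma δ_comp_eq {S S' : ShortComplex C} (hS : E.conflation S) (hS' : E.conflation S')
    (hI' : E.IsInjective S'.X₂) (φ : S ⟶ S') :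
    σ.δ hF hS ≫ (L.map φ.τ₁)⟦(1 : ℤ)⟧' = -(L.map φ.τ₃ ≫ (σ.iso S' hS' hI').hom) := by
  obtain ⟨χ, hχ⟩ := exists_hom_of_isInjective (hF.conflation_hull S.X₁) hI' φ.τ₁
  have h₁ := σ.natural _ _ (hF.conflation_hull S.X₁) (hF.isInjective_hull _) hS' hI' χ
  have h₂ := hF.map_τ₃_comp L hS hI' (φ := hF.homHull hS (𝟙 S.X₁)) (ψ := χ) (χ := φ) (by
    rw [homHull_τ₁, hχ]; exact Category.id_comp _)
  rw [δ, Preadditive.neg_comp, Category.assoc, neg_inj, ← h₂, Category.assoc, h₁, hχ]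

lemma δ_of_isInjective {S : ShortComplex C} (hS : E.conflation S) (hI : E.IsInjective S.X₂) :
    σ.δ hF hS = -(σ.iso S hS hI).hom := by
  simpa using σ.δ_comp_eq hF hS hS hI (𝟙 S)

lemma δ_naturality {S S' : ShortComplex C} (hS : E.conflation S) (hS' : E.conflation S')
    (φ : S ⟶ S') :
    σ.δ hF hS ≫ (L.map φ.τ₁)⟦(1 : ℤ)⟧' = L.map φ.τ₃ ≫ σ.δ hF hS' := by
  have h := σ.δ_comp_eq hF hS (hF.conflation_hull _) (hF.isInjective_hull _)
    (φ ≫ hF.homHull hS' (𝟙 _))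
  rw [ShortComplex.comp_τ₁, homHull_τ₁, ShortComplex.comp_τ₃, L.map_comp, L.map_comp, L.map_id,
    Category.comp_id] at h
  rw [h, δ, Preadditive.comp_neg, Category.assoc]

/-- The triangle attached to a conflation. -/
noncomputable abbrev triangle {S : ShortComplex C} (hS : E.conflation S) : Triangle H :=
  Triangle.mk (L.map S.f) (L.map S.g) (σ.δ hF hS)

variable {σ}

omit [HasZeroObject C] [HasBinaryBiproducts C] [L.IsLocalization E.stableEquivalences]
  [Preadditive H] in
lemma IsStandardTriangle.of_iso {T T' : Triangle H} (hT : σ.IsStandardTriangle T) (e : T' ≅ T) :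
    σ.IsStandardTriangle T' := by
  obtain ⟨S, hS, hI, Y, Z, u, v, k, w, h₁, h₂, h₃, ⟨e'⟩⟩ := hT
  exact ⟨S, hS, hI, Y, Z, u, v, k, w, h₁, h₂, h₃, ⟨e ≪≫ e'⟩⟩

variable [L.Additive]

include hF

/-- The cone sits in the conflation `X ⟶ Y ⊞ I ⟶ Z`, and `Y ⟶ Y ⊞ I` is a stable isomorphism. -/
lemma IsStandardTriangle.exists_conflation {T : Triangle H} (hT : σ.IsStandardTriangle T) :
    ∃ (S : ShortComplex C) (hS : E.conflation S), Nonempty (T ≅ σ.triangle hF hS) := by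
  obtain ⟨S, hS, hI, Y, Z, u, v, k, w, h₁, h₂, h₃, ⟨e⟩⟩ := hT
  have hS' := conflation_lift_of_isPushout h₁ (isInflation_f hS)
  refine ⟨_, hS', ⟨e ≪≫ ?_⟩⟩
  have := hF.isIso_map_inl L (X := Y) hI
  let φ : ShortComplex.mk (biprod.lift u S.f) (biprod.desc v (-k)) (by simp [h₁.w]) ⟶ S :=
    ShortComplex.homMk (𝟙 _) biprod.snd (-w) (by simp) (by ext <;> simp [h₂, h₃])
  have hδ := σ.δ_comp_eq hF hS' hS hI φ
  refine triangleMkIso (Iso.refl _) (asIso (L.map biprod.inl)) (Iso.refl _) ?_ ?_ ?_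
  · dsimp
    rw [Category.id_comp, ← L.map_comp]
    exact hF.map_eq_of_fac L hI S.f (-biprod.inr) (by ext <;> simp)
  · dsimp
    rw [Category.comp_id, ← L.map_comp, biprod.inl_desc]
  · simpa [φ] using hδ.symm

/-- The pushout `Z` of the hull of `S.X₁` along `S.f` maps to `S.X₃` by a deflation `π` with
injective kernel `J.X₂`, so the cone of `S.f` is stably `S.X₃`. -/
lemma isStandardTriangle_triangle {S : ShortComplex C} (hS : E.conflation S) :
    σ.IsStandardTriangle (σ.triangle hF hS) := by
  let J := hF.hull S.X₁
  have hJ : E.conflation J := hF.conflation_hull S.X₁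
  have hI : E.IsInjective J.X₂ := hF.isInjective_hull S.X₁
  let φ : S ⟶ J := hF.homHull hS (𝟙 S.X₁)
  have hφ : S.f ≫ φ.τ₂ = J.f := by
    rw [← φ.comm₁₂]
    exact (congrArg (· ≫ J.f) (hF.homHull_τ₁ hS (𝟙 S.X₁))).trans (Category.id_comp _)
  obtain ⟨Z, k, v, sq, -⟩ := E.pushout_inflation (Y := J.X₂) J.f S.f (isInflation_f hJ)
  let w : Z ⟶ J.X₃ := sq.desc J.g 0 (by simp)
  let π : Z ⟶ S.X₃ := sq.desc 0 S.g (by simp)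
  have hvw : v ≫ w = 0 := by simp [w]
  have hkw : k ≫ w = J.g := by simp [w]
  have hvπ : v ≫ π = S.g := by simp [π]
  have hkπ : k ≫ π = 0 := by simp [π]
  have hπ : IsIso (L.map π) :=
    hF.isIso_map_g L (conflation_of_isPushout hS sq.flip hkπ hvπ) hI
  refine ⟨J, hJ, hI, S.X₂, Z, S.f, v, k, w, sq, hvw, hkw, ⟨Iso.symm ?_⟩⟩
  refine triangleMkIso (Iso.refl _) (Iso.refl _) (asIso (L.map π)) (by simp) ?_ ?_
  · dsimp
    rw [Category.id_comp, ← L.map_comp, hvπ]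
  -- The sum `w + π ≫ φ.τ₃` factors through the injective `J.X₂`, as the map induced by `𝟙` and
  -- `φ.τ₂` followed by `J.g`.
  · have h : L.map w = L.map (-(π ≫ φ.τ₃)) := by
      refine hF.map_eq_of_fac L hI (sq.desc (𝟙 _) φ.τ₂ (by rw [hφ]; exact Category.comp_id _)) J.g
        (sq.hom_ext ?_ ?_)
      · simp [hkw, reassoc_of% hkπ]
      · simp [hvw, reassoc_of% hvπ, φ.comm₂₃]
    dsimp [δ]
    rw [h]
    simp [J, φ]

omit [L.Additive] in
/-- The rotation of a standard triangle is the triangle of a conflation. -/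
lemma nonempty_rotate_iso {S : ShortComplex C} (hS : E.conflation S) (hI : E.IsInjective S.X₂)
    {Y Z : C} {u : S.X₁ ⟶ Y} {v : Y ⟶ Z} {k : S.X₂ ⟶ Z} {w : Z ⟶ S.X₃}
    (h₁ : IsPushout S.f u k v) (h₂ : v ≫ w = 0) (h₃ : k ≫ w = S.g) :
    Nonempty ((Triangle.mk (L.map u) (L.map v) (L.map w ≫ (σ.iso S hS hI).hom)).rotate ≅
      σ.triangle hF (conflation_of_isPushout hS h₁ h₂ h₃)) := by
  let φ : S ⟶ ShortComplex.mk v w h₂ := ShortComplex.homMk u k (𝟙 _) h₁.w.symm (by simp [h₃])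
  have hδ := σ.δ_naturality hF hS (conflation_of_isPushout hS h₁ h₂ h₃) φ
  rw [σ.δ_of_isInjective hF hS hI] at hδ
  change Nonempty (Triangle.mk (L.map v) (L.map w ≫ (σ.iso S hS hI).hom)
    (-(L.map u)⟦(1 : ℤ)⟧') ≅ _)
  refine ⟨triangleMkIso (Iso.refl _) (Iso.refl _) (σ.iso S hS hI).symm (by simp)
    (by simp) ?_⟩
  rw [← cancel_epi (σ.iso S hS hI).hom]
  simpa [φ] using hδ

lemma IsStandardTriangle.rotate {T : Triangle H} (hT : σ.IsStandardTriangle T)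
    [∀ n : ℤ, (shiftFunctor H n).Additive] :
    σ.IsStandardTriangle T.rotate := by
  obtain ⟨S, hS, hI, Y, Z, u, v, k, w, h₁, h₂, h₃, ⟨e⟩⟩ := hT
  obtain ⟨e'⟩ := σ.nonempty_rotate_iso hF hS hI h₁ h₂ h₃
  exact (isStandardTriangle_triangle hF _).of_iso ((Pretriangulated.rotate H).mapIso e ≪≫ e')

lemma IsStandardTriangle.of_rotate {T : Triangle H} (hT : σ.IsStandardTriangle T.rotate)
    [∀ n : ℤ, (shiftFunctor H n).Additive] :
    σ.IsStandardTriangle T := by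
  obtain ⟨S, hS, ⟨e⟩⟩ := hT.exists_conflation hF
  -- With `K` the kernel of `P ⟶ S.X₂ ⟶ S.X₃`, the object `S.X₂` is the pushout of `K ⟶ P` along
  -- `x`. So `S` comes from the cone of `x`, whose standard triangle rotates to `T.rotate`; rotation
  -- is fully faithful, hence reflects this isomorphism.
  obtain ⟨P, y, hP, hy⟩ := hF.enough_projectives S.X₂
  obtain ⟨K, i, hi, hK⟩ := E.comp_deflation y S.g hy (isDeflation_g hS)
  obtain ⟨x, hx⟩ := exists_lift hS (i ≫ y) (by simpa using hi)
  have sq := isPushout_of_comp_deflation hS hK (x := x) (y := y) (z := 𝟙 _) hx.symm (by simp) hy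
  obtain ⟨e'⟩ := σ.nonempty_rotate_iso hF hK (hF.isInjective hP) sq S.zero rfl
  refine IsStandardTriangle.of_iso ⟨_, hK, hF.isInjective hP, _, _, _, _, _, _, sq, S.zero, rfl,
    ⟨Iso.refl _⟩⟩ ((Pretriangulated.rotate H).preimageIso (e ≪≫ e'.symm))

lemma IsStandardTriangle.exists_hom₃ {T T' : Triangle H} (hT : σ.IsStandardTriangle T)
    (hT' : σ.IsStandardTriangle T') (a : T.obj₁ ⟶ T'.obj₁) (b : T.obj₂ ⟶ T'.obj₂)
    (hab : T.mor₁ ≫ b = a ≫ T'.mor₁) :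
    ∃ c : T.obj₃ ⟶ T'.obj₃, T.mor₂ ≫ c = b ≫ T'.mor₂ ∧ T.mor₃ ≫ a⟦1⟧' = c ≫ T'.mor₃ := by
  obtain ⟨S, hS, ⟨e⟩⟩ := hT.exists_conflation hF
  obtain ⟨S', hS', ⟨e'⟩⟩ := hT'.exists_conflation hF
  refine exists_hom₃_of_iso e e' (fun a b hab ↦ ?_) a b hab
  obtain ⟨φ, rfl, rfl⟩ := hF.exists_hom_of_comm hS a b hab
  refine ⟨L.map φ.τ₃, ?_, σ.δ_naturality hF hS hS' φ⟩
  exact (L.map_comp _ _).symm.trans ((congrArg L.map φ.comm₂₃.symm).trans (L.map_comp _ _))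

lemma isStandardTriangle_contractible [HasZeroObject H] (X : H) :
    σ.IsStandardTriangle (contractibleTriangle X) := by
  have := Localization.essSurj L E.stableEquivalences
  obtain ⟨Y, ⟨e⟩⟩ : ∃ Y, Nonempty (X ≅ L.obj Y) := ⟨_, ⟨(L.objObjPreimageIso X).symm⟩⟩
  have h0 : IsZero (L.obj (0 : C)) := L.map_isZero (isZero_zero C)
  refine (isStandardTriangle_triangle hF (conflation_id_zero Y)).of_iso
    (triangleMkIso e e ((isZero_zero H).iso h0) (by simp) ?_ ?_)
  · exact h0.eq_of_tgt _ _
  · exact (isZero_zero H).eq_of_src _ _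

end

variable (σ : SuspensionIso E L) [L.Additive] [HasZeroObject H]
  [∀ n : ℤ, (shiftFunctor H n).Additive]

/-- The pretriangulated structure on the localization of a Frobenius category. -/
@[reducible]
noncomputable def pretriangulated : Pretriangulated H where
  distinguishedTriangles := {T | σ.IsStandardTriangle T}
  isomorphic_distinguished _ hT _ e := hT.of_iso e
  contractible_distinguished X := isStandardTriangle_contractible hF X
  distinguished_cocone_triangle {X Y} f := by
    have := Localization.essSurj L E.stableEquivalences
    obtain ⟨X', ⟨e⟩⟩ : ∃ Z, Nonempty (X ≅ L.obj Z) := ⟨_, ⟨(L.objObjPreimageIso X).symm⟩⟩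
    obtain ⟨Z, W, i, g, w, e', h, comm⟩ := hF.exists_inflation L f e
    refine ⟨L.obj W, e'.hom ≫ L.map g, σ.δ hF h ≫ e.inv⟦1⟧', ?_⟩
    refine (isStandardTriangle_triangle hF h).of_iso
      (triangleMkIso e e' (Iso.refl _) comm (by simp) ?_)
    simp [← Functor.map_comp]
  rotate_distinguished_triangle _ := ⟨fun hT ↦ hT.rotate hF, fun hT ↦ hT.of_rotate hF⟩
  complete_distinguished_triangle_morphism _ _ hT hT' a b h := hT.exists_hom₃ hF hT' a b h

/-- Two composable morphisms become composable inflations. Noether's conflation of cokernels is the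
fourth triangle, and the squares involving connecting morphisms are instances of `δ_naturality`. -/
lemma isTriangulated :
    letI := σ.pretriangulated hF
    IsTriangulated H := by
  let := σ.pretriangulated hF
  refine IsTriangulated.mk' (fun X₁ X₂ X₃ u₁₂ u₂₃ ↦ ?_)
  have := Localization.essSurj L E.stableEquivalences
  obtain ⟨X, ⟨e₁⟩⟩ : ∃ Z, Nonempty (X₁ ≅ L.obj Z) := ⟨_, ⟨(L.objObjPreimageIso X₁).symm⟩⟩
  obtain ⟨Y, P, u, p, w, e₂, h, comm⟩ := hF.exists_inflation L u₁₂ e₁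
  obtain ⟨Z, Q, v, q, w', e₃, h', comm'⟩ := hF.exists_inflation L u₂₃ e₂
  obtain ⟨R, p', m, c, w₁, w₂, h₁, h₂, comm₁, comm₂⟩ := exists_noether h h'
  have hd : σ.δ hF h ≫ (L.map (𝟙 X))⟦(1 : ℤ)⟧' = L.map m ≫ σ.δ hF h₁ :=
    σ.δ_naturality hF h h₁ (ShortComplex.homMk (𝟙 _) v m (by simp) comm₁.symm)
  have hd' : σ.δ hF h₁ ≫ (L.map u)⟦(1 : ℤ)⟧' = L.map c ≫ σ.δ hF h' :=
    σ.δ_naturality hF h₁ h' (ShortComplex.homMk u (𝟙 _) c (by simp) (by simp [comm₂]))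
  have hd'' : σ.δ hF h' ≫ (L.map p)⟦(1 : ℤ)⟧' = L.map (𝟙 Q) ≫ σ.δ hF h₂ :=
    σ.δ_naturality hF h' h₂ (ShortComplex.homMk p p' (𝟙 _) comm₁ (by simp [comm₂]))
  rw [L.map_id, CategoryTheory.Functor.map_id, Category.comp_id] at hd
  rw [L.map_id, Category.id_comp] at hd''
  refine ⟨_, _, _, _, _, _, L.map u, L.map v, e₁, e₂, e₃, comm, comm', L.map p, σ.δ hF h,
    isStandardTriangle_triangle hF h, L.map q, σ.δ hF h', isStandardTriangle_triangle hF h',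
    L.map p', σ.δ hF h₁, ?_,
    ⟨⟨L.map m, L.map c, ?_, ?_, ?_, hd', ?_⟩⟩⟩
  · rw [← L.map_comp]
    exact isStandardTriangle_triangle hF h₁
  · rw [← L.map_comp, ← L.map_comp, comm₁]
  · exact hd.symm
  · rw [← L.map_comp, comm₂]
  · rw [hd'']
    exact isStandardTriangle_triangle hF h₂

end SuspensionIso

end Triangulation

end FrobeniusCoslice

theorem theorem3p5
    {F : Type*} [Category F] [Preadditive F] [HasZeroObject F] [HasBinaryBiproducts F]
    (E : FrobeniusCoslice.ExactStructure F)
    (hF : E.IsFrobenius) (hwic : FrobeniusCoslice.IsWeaklyIdempotentComplete F)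
    (A : F) (hA : ¬ IsZero A) (hproj : E.IsProjective A) (hinj : E.IsInjective A)
    {H : Type*} [Category H] (L : Under A ⥤ H)
    [L.IsLocalization (E.coslicedWeakEquivalences A)] :
    ¬ HasZeroObject (Under A) ∧
    ∃ (_ : Preadditive H) (_ : HasZeroObject H) (_ : HasShift H ℤ)
      (_ : ∀ n : ℤ, (shiftFunctor H n).Additive) (_ : Pretriangulated H),
      IsTriangulated H ∧
      ∃ σ : FrobeniusCoslice.SuspensionIso E (FrobeniusCoslice.inclFunctor A ⋙ L),
        ∀ T : Pretriangulated.Triangle H,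
          T ∈ distTriang H ↔ σ.IsStandardTriangle T := by
  refine ⟨fun ⟨Z, hZ⟩ ↦ hA ?_, ?_⟩
  -- Through a zero object there would be a morphism under `A` from `A ⟶ 0` to `𝟙 A`, so `𝟙 A` would
  -- factor through `0`.
  · let f : Z ⟶ Under.mk (𝟙 A) := hZ.to_ _
    let g : Under.mk (0 : A ⟶ 0) ⟶ Z := hZ.from_ _
    have h : (0 : A ⟶ 0) ≫ g.right ≫ f.right = 𝟙 A := by
      simpa using Under.w (g ≫ f)
    rw [IsZero.iff_id_eq_zero, ← h, zero_comp]
  · let Φ := FrobeniusCoslice.inclFunctor A ⋙ L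
    have : Φ.IsLocalization E.stableEquivalences := E.isLocalization_inclFunctor_comp hproj hinj L
    obtain ⟨_, ⟨σ⟩⟩ := hF.exists_suspensionIso Φ
    let : Preadditive H := E.preadditiveOfIsLocalization Φ
    have : Φ.Additive := E.additive_of_isLocalization Φ
    have := Localization.essSurj Φ E.stableEquivalences
    have : HasZeroObject H := ⟨_, Φ.map_isZero (isZero_zero F)⟩
    have : HasFiniteProducts F := hasFiniteProducts_of_has_binary_and_terminal
    have : HasFiniteProducts H := Functor.hasFiniteProducts_of_additive_of_essSurj Φ
    -- Shift functors are equivalences, so they preserve binary products and are additive.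
    have (n : ℤ) : (shiftFunctor H n).Additive := Functor.additive_of_preserves_binary_products _
    exact ⟨_, _, _, _, σ.pretriangulated hF, σ.isTriangulated hF, σ, fun _ ↦ Iff.rfl⟩
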